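/- Let $K$ be a field, let $A$ be a nilpotent $d\times d$ matrix over $K$, and let $\mathrm{Cen}(A)=\{B\in M_d(K) : AB=BA\}$ be its centralizer, a $K$-algebra with Jacobson radical $J=J(\mathrm{Cen}(A))$. Then $A$ is similar over $K$ to a block diagonal matrix whose diagonal blocks are nilpotent elementary Jordan matrices (ones directly above the diagonal and zeros elsewhere), of sizes $k_1\ge k_2\ge\dots\ge k_m\ge 1$. For every such choice of sizes, let $n=\max\{k_1,\dots,k_m\}$ be the largest block size ($n=0$ if $d=0$), let $v$ be the number of different block sizes, and for $1\le e\le n$ let $p_e$ be the number of indices $i$ with $k_i=e$. Then there is an isomorphism of $K$-algebras $$\mathrm{Cen}(A)/J\;\cong\; M_{p_1}(K)\oplus M_{p_2}(K)\oplus\cdots\oplus M_{p_n}(K),$$ where $M_{p_e}(K)=\{0\}$ if $p_e=0$. Moreover, $J$ is nilpotent, and its index of nilpotency, that is, the least $r\ge 0$ with $J^r=\{0\}$, is at most $nv$. -/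

import Mathlib

namespace MatrixCentralizer

/-- The nilpotent elementary Jordan matrix of size `s × s`: ones directly above the diagonal,
zeros everywhere else. -/
def jordanBlock (K : Type*) [Field K] (s : ℕ) : Matrix (Fin s) (Fin s) K :=
  Matrix.of fun i j => if (i : ℕ) + 1 = (j : ℕ) then 1 else 0

/-- The block diagonal matrix whose diagonal blocks are the nilpotent elementary Jordan matrices
of sizes `k 0, …, k (m - 1)`. -/
def jordanMatrix (K : Type*) [Field K] {m : ℕ} (k : Fin m → ℕ) :
    Matrix (Σ i : Fin m, Fin (k i)) (Σ i : Fin m, Fin (k i)) K :=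
  Matrix.blockDiagonal' fun i => jordanBlock K (k i)

/-- The canonical Jordan form of the (nilpotent) matrix `A` consists of `m` elementary Jordan
matrices of sizes `k 0 ≥ k 1 ≥ … ≥ k (m - 1) ≥ 1`: in some basis of `K ^ d` the linear map
`x ↦ A x` has the matrix `jordanMatrix K k`. -/
structure HasJordanBlockSizes {K : Type*} [Field K] {d : ℕ} (A : Matrix (Fin d) (Fin d) K)
    {m : ℕ} (k : Fin m → ℕ) : Prop where
  antitone : Antitone k
  one_le : ∀ i, 1 ≤ k i
  exists_basis : ∃ b : Module.Basis (Σ i : Fin m, Fin (k i)) K (Fin d → K),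
    LinearMap.toMatrix b b (Matrix.toLin' A) = jordanMatrix K k

/-- The number of blocks of size `e` among blocks of sizes `k 0, …, k (m - 1)`. -/
def blockCount {m : ℕ} (k : Fin m → ℕ) (e : ℕ) : ℕ :=
  (Finset.univ.filter fun i => k i = e).card

/-- The largest block size (`0` if there are no blocks). -/
def maxBlockSize {m : ℕ} (k : Fin m → ℕ) : ℕ :=
  Finset.univ.sup k

/-- The number of different block sizes. -/
def numBlockSizes {m : ℕ} (k : Fin m → ℕ) : ℕ :=
  (Finset.univ.image k).card

/-- The centralizer of the matrix `A`, as a `K`-subalgebra of the full matrix algebra. -/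
abbrev Cen {K : Type*} [Field K] {d : ℕ} (A : Matrix (Fin d) (Fin d) K) :
    Subalgebra K (Matrix (Fin d) (Fin d) K) :=
  Subalgebra.centralizer K {A}

end MatrixCentralizer

/-! In a Jordan basis, a matrix commuting with the Jordan matrix has upper triangular Toeplitz
blocks, and the constant coefficient of block `(i, j)` vanishes when `k i < k j`. Hence reading off
the constant coefficients between blocks of equal size is multiplicative, and maps the centralizer
onto the product of the `M_{p_e}(K)`. Rank the basis vectors lexicographically, by position in the
block and then by decreasing block size (`basisRank`). A nonzero entry of a kernel element joins a
row to a column of strictly larger rank; ranks are below `n * v`, so the `n * v`-th power of the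
kernel is zero. A nilpotent ideal lies in the radical, and the target is semisimple, so the kernel
is exactly `J`. Existence of the Jordan form is the structure theorem for torsion modules over
`K[X]`. -/

theorem Ideal.le_ringJacobson_of_isNilpotent {R : Type*} [Ring R] {I : Ideal R}
    (hI : IsNilpotent I) : I ≤ Ring.jacobson R := by
  obtain ⟨n, hn⟩ := hI
  rw [Ring.jacobson_eq_sInf_isMaximal]
  refine le_sInf fun m hm x hx => ?_
  have hm : m.IsMaximal := hm
  by_contra hxm
  -- Maximality gives `r * x + i = 1` with `i ∈ m`; as `r * x` is nilpotent, `i = 1 - r * x` is a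
  -- unit.
  obtain ⟨r, hr⟩ := hm.exists_inv hxm
  obtain ⟨i, hi, h⟩ := hr
  have hnil : IsNilpotent (r * x) := by
    refine ⟨n, ?_⟩
    have := Ideal.pow_mem_pow (I.mul_mem_left r hx) n
    rw [hn] at this
    exact this
  have hu := hnil.isUnit_one_sub
  rw [← h, add_sub_cancel_left] at hu
  exact hm.ne_top (Ideal.eq_top_of_isUnit_mem _ hi hu)

/-- A surjection onto a semisimple ring with nilpotent kernel identifies the Jacobson radical. -/
theorem AlgHom.jacobson_eq_ker_of_surjective {K R S : Type*} [CommSemiring K] [Ring R] [Ring S]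
    [Algebra K R] [Algebra K S] [IsSemisimpleRing S] {f : R →ₐ[K] S}
    (hf : Function.Surjective f) (hker : IsNilpotent (RingHom.ker f)) :
    Ring.jacobson R = RingHom.ker f := by
  refine le_antisymm ?_ (Ideal.le_ringJacobson_of_isNilpotent hker)
  have : RingHomSurjective (f : R →+* S) := ⟨hf⟩
  have h := Ring.le_comap_jacobson (f : R →+* S)
  rw [IsSemisimpleRing.jacobson_eq_bot S] at h
  exact h

theorem AlgHom.nonempty_quotient_jacobson_algEquiv {K R S : Type*} [CommSemiring K] [Ring R]
    [Ring S] [Algebra K R] [Algebra K S] [IsSemisimpleRing S] {f : R →ₐ[K] S}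
    (hf : Function.Surjective f) {r : ℕ} (hker : RingHom.ker f ^ r = ⊥) :
    Nonempty ((R ⧸ Ring.jacobson R) ≃ₐ[K] S) ∧ IsNilpotent (Ring.jacobson R) ∧
      nilpotencyClass (Ring.jacobson R) ≤ r := by
  have h := AlgHom.jacobson_eq_ker_of_surjective hf ⟨r, hker⟩
  refine ⟨⟨(Ideal.quotientEquivAlgOfEq K h).trans (Ideal.quotientKerAlgEquivOfSurjective hf)⟩,
    ?_, ?_⟩
  · rw [h]; exact ⟨r, hker⟩
  · rw [h]; exact Nat.sInf_le hker

/-! ### Toeplitz structure of the commuting matrices -/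

namespace MatrixCentralizer

open Finset

variable {K : Type*} [Field K] {m : ℕ} {k : Fin m → ℕ}

theorem jordanMatrix_apply (x y : Σ i : Fin m, Fin (k i)) :
    jordanMatrix K k x y = if x.1 = y.1 ∧ (x.2 : ℕ) + 1 = y.2 then 1 else 0 := by
  obtain ⟨i, s⟩ := x
  obtain ⟨j, t⟩ := y
  by_cases h : i = j
  · subst h
    simp [jordanMatrix, jordanBlock]
  · simp [jordanMatrix, Matrix.blockDiagonal'_apply_ne, h]

theorem jordanMatrix_mul_apply_of_lt (B : Matrix (Σ i, Fin (k i)) (Σ i, Fin (k i)) K) {i : Fin m}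
    {s : ℕ} (h : s + 1 < k i) (y : Σ i, Fin (k i)) :
    (jordanMatrix K k * B) ⟨i, ⟨s, by omega⟩⟩ y = B ⟨i, ⟨s + 1, h⟩⟩ y := by
  rw [Matrix.mul_apply, sum_eq_single ⟨i, ⟨s + 1, h⟩⟩]
  · simp [jordanMatrix_apply]
  · rintro ⟨j, t, ht⟩ - hne
    rw [jordanMatrix_apply, if_neg, zero_mul]
    rintro ⟨h1, h2⟩
    dsimp at h1 h2
    subst h1 h2
    exact hne rfl
  · simp

theorem jordanMatrix_mul_apply_of_eq (B : Matrix (Σ i, Fin (k i)) (Σ i, Fin (k i)) K) {i : Fin m}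
    {s : ℕ} (h : s + 1 = k i) (y : Σ i, Fin (k i)) :
    (jordanMatrix K k * B) ⟨i, ⟨s, by omega⟩⟩ y = 0 := by
  rw [Matrix.mul_apply]
  refine sum_eq_zero ?_
  rintro ⟨j, t, ht⟩ -
  rw [jordanMatrix_apply, if_neg, zero_mul]
  rintro ⟨h1, h2⟩
  dsimp at h1 h2
  subst h1
  omega

theorem mul_jordanMatrix_apply_succ (B : Matrix (Σ i, Fin (k i)) (Σ i, Fin (k i)) K) {j : Fin m}
    {t : ℕ} (h : t + 1 < k j) (x : Σ i, Fin (k i)) :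
    (B * jordanMatrix K k) x ⟨j, ⟨t + 1, h⟩⟩ = B x ⟨j, ⟨t, by omega⟩⟩ := by
  rw [Matrix.mul_apply, sum_eq_single ⟨j, ⟨t, by omega⟩⟩]
  · simp [jordanMatrix_apply]
  · rintro ⟨i, s, hs⟩ - hne
    rw [jordanMatrix_apply, if_neg, mul_zero]
    rintro ⟨h1, h2⟩
    dsimp at h1 h2
    obtain rfl : s = t := by omega
    subst h1
    exact hne rfl
  · simp

theorem mul_jordanMatrix_apply_zero (B : Matrix (Σ i, Fin (k i)) (Σ i, Fin (k i)) K) {j : Fin m}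
    (h : 0 < k j) (x : Σ i, Fin (k i)) :
    (B * jordanMatrix K k) x ⟨j, ⟨0, h⟩⟩ = 0 := by
  rw [Matrix.mul_apply]
  refine sum_eq_zero fun y _ => ?_
  rw [jordanMatrix_apply, if_neg, mul_zero]
  simp

section Commute

variable {B : Matrix (Σ i, Fin (k i)) (Σ i, Fin (k i)) K} (hB : Commute (jordanMatrix K k) B)
include hB

/-- The blocks of a matrix commuting with a Jordan matrix are Toeplitz matrices. -/
theorem apply_succ_succ {i j : Fin m} {s t : ℕ} (hs : s + 1 < k i) (ht : t + 1 < k j) :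
    B ⟨i, ⟨s + 1, hs⟩⟩ ⟨j, ⟨t + 1, ht⟩⟩ = B ⟨i, ⟨s, by omega⟩⟩ ⟨j, ⟨t, by omega⟩⟩ := by
  rw [← jordanMatrix_mul_apply_of_lt B hs, hB.eq, mul_jordanMatrix_apply_succ B ht]

theorem apply_eq_zero_of_lt {i j : Fin m} {s t : ℕ} (hs : s < k i) (ht : t < k j) (h : t < s) :
    B ⟨i, ⟨s, hs⟩⟩ ⟨j, ⟨t, ht⟩⟩ = 0 := by
  induction t generalizing s with
  | zero =>
    obtain ⟨s, rfl⟩ := Nat.exists_eq_succ_of_ne_zero h.ne'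
    rw [← jordanMatrix_mul_apply_of_lt B hs, hB.eq, mul_jordanMatrix_apply_zero B ht]
  | succ t ih =>
    obtain ⟨s, rfl⟩ := Nat.exists_eq_succ_of_ne_zero (Nat.ne_zero_of_lt h)
    rw [apply_succ_succ hB]
    exact ih _ _ (by omega)

theorem apply_same {i j : Fin m} {s : ℕ} (hi : s < k i) (hj : s < k j) :
    B ⟨i, ⟨s, hi⟩⟩ ⟨j, ⟨s, hj⟩⟩ = B ⟨i, ⟨0, by omega⟩⟩ ⟨j, ⟨0, by omega⟩⟩ := by
  induction s with
  | zero => rfl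
  | succ s ih =>
    rw [apply_succ_succ hB]
    exact ih _ _

/-- Slide down the diagonal to the last row of block `i`. Since block `j` is wider, this entry is
also the next entry of that row in `B * jordanMatrix K k`, and the last row of block `i` in
`jordanMatrix K k * B` is zero. -/
theorem apply_zero_zero_of_lt {i j : Fin m} (hi : 0 < k i) (h : k i < k j) :
    B ⟨i, ⟨0, hi⟩⟩ ⟨j, ⟨0, by omega⟩⟩ = 0 := by
  rw [← apply_same hB (s := k i - 1) (by omega) (by omega),
    ← mul_jordanMatrix_apply_succ B (t := k i - 1) (by omega), ← hB.eq,
    jordanMatrix_mul_apply_of_eq B (by omega)]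

end Commute

theorem mul_apply_zero_zero {B C : Matrix (Σ i, Fin (k i)) (Σ i, Fin (k i)) K}
    (hC : Commute (jordanMatrix K k) C) (hk : ∀ i, 0 < k i) (i j : Fin m) :
    (B * C) ⟨i, ⟨0, hk i⟩⟩ ⟨j, ⟨0, hk j⟩⟩ =
      ∑ l, B ⟨i, ⟨0, hk i⟩⟩ ⟨l, ⟨0, hk l⟩⟩ * C ⟨l, ⟨0, hk l⟩⟩ ⟨j, ⟨0, hk j⟩⟩ := by
  rw [Matrix.mul_apply, Fintype.sum_sigma]
  refine sum_congr rfl fun l _ => ?_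
  refine sum_eq_single _ (fun u _ hu => ?_) (by simp)
  obtain ⟨u, hul⟩ := u
  rw [apply_eq_zero_of_lt hC hul (hk j) (Nat.pos_of_ne_zero fun h => hu (by simp [h])), mul_zero]

/-! ### The semisimple quotient -/

/-- The centralizer of the Jordan matrix. -/
abbrev jordanCen (K : Type*) [Field K] {m : ℕ} (k : Fin m → ℕ) :
    Subalgebra K (Matrix (Σ i : Fin m, Fin (k i)) (Σ i : Fin m, Fin (k i)) K) :=
  Subalgebra.centralizer K {jordanMatrix K k}

theorem mem_jordanCen {B : Matrix (Σ i, Fin (k i)) (Σ i, Fin (k i)) K} :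
    B ∈ jordanCen K k ↔ Commute (jordanMatrix K k) B := by
  simp [jordanCen, Subalgebra.mem_centralizer_iff, Commute, SemiconjBy]

/-- The constant coefficients of the Toeplitz blocks between Jordan blocks of size `e`. -/
def sizeBlockHom (hk : ∀ i, 0 < k i) (e : ℕ) :
    jordanCen K k →ₐ[K] Matrix {i // k i = e} {i // k i = e} K :=
  AlgHom.ofLinearMap
    { toFun := fun B => Matrix.of fun i j => B.1 ⟨i.1, ⟨0, hk i.1⟩⟩ ⟨j.1, ⟨0, hk j.1⟩⟩
      map_add' := fun _ _ => rfl
      map_smul' := fun _ _ => rfl }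
    (by
      ext i j
      change (1 : Matrix (Σ i, Fin (k i)) (Σ i, Fin (k i)) K) ⟨i.1, ⟨0, hk i.1⟩⟩
        ⟨j.1, ⟨0, hk j.1⟩⟩ = _
      by_cases h : i = j
      · subst h
        rw [Matrix.one_apply_eq, Matrix.one_apply_eq]
      · rw [Matrix.one_apply_ne h, Matrix.one_apply_ne]
        exact fun h' => h (Subtype.ext (congrArg Sigma.fst h')))
    (by
      rintro ⟨B, hB⟩ ⟨C, hC⟩
      rw [mem_jordanCen] at hB hC
      ext ⟨i, hi⟩ ⟨j, hj⟩
      change (B * C) ⟨i, ⟨0, hk i⟩⟩ ⟨j, ⟨0, hk j⟩⟩ = _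
      rw [mul_apply_zero_zero hC hk, Matrix.mul_apply]
      refine Eq.trans ?_ (sum_subtype (univ.filter fun l => k l = e) (by simp)
        (fun l => B ⟨i, ⟨0, hk i⟩⟩ ⟨l, ⟨0, hk l⟩⟩ * C ⟨l, ⟨0, hk l⟩⟩ ⟨j, ⟨0, hk j⟩⟩))
      refine (sum_filter_of_ne fun l _ hne => ?_).symm
      -- An intermediate block of another size contributes nothing: a smaller one kills the factor
      -- from `C`, a larger one the factor from `B`.
      rcases lt_trichotomy (k l) e with h | h | h
      · rw [apply_zero_zero_of_lt hC (hk l) (by omega), mul_zero] at hne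
        exact absurd rfl hne
      · exact h
      · rw [apply_zero_zero_of_lt hB (hk i) (by omega), zero_mul] at hne
        exact absurd rfl hne)

/-- An enumeration of the blocks of size `e`. -/
noncomputable def blockEquiv (k : Fin m → ℕ) (e : ℕ) : {i // k i = e} ≃ Fin (blockCount k e) :=
  Fintype.equivFinOfCardEq (Fintype.card_subtype _)

/-- The map from the centralizer of the Jordan matrix to its semisimple quotient. -/
noncomputable def blocksHom (hk : ∀ i, 0 < k i) :
    jordanCen K k →ₐ[K] ((e : Finset.Icc 1 (maxBlockSize k)) →
      Matrix (Fin (blockCount k e)) (Fin (blockCount k e)) K) :=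
  AlgHom.pi fun e => (Matrix.reindexAlgEquiv K K (blockEquiv k e)).toAlgHom.comp
    (sizeBlockHom hk e)

theorem blocksHom_apply (hk : ∀ i, 0 < k i) (B : jordanCen K k)
    (e : Finset.Icc 1 (maxBlockSize k)) (p q : Fin (blockCount k e)) :
    blocksHom hk B e p q = B.1 ⟨((blockEquiv k e).symm p).1, ⟨0, hk _⟩⟩
      ⟨((blockEquiv k e).symm q).1, ⟨0, hk _⟩⟩ :=
  rfl

theorem size_mem_Icc (hk : ∀ i, 0 < k i) (i : Fin m) : k i ∈ Finset.Icc 1 (maxBlockSize k) :=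
  Finset.mem_Icc.2 ⟨hk i, Finset.le_sup (f := k) (mem_univ i)⟩

/-- Each block is a scalar multiple of an identity matrix, or zero if the sizes differ; these
matrices provide the preimages for surjectivity. -/
theorem commute_jordanMatrix_of_size_eq (D : Fin m → Fin m → K)
    (hD : ∀ i j, k i ≠ k j → D i j = 0) :
    Commute (jordanMatrix K k)
      (Matrix.of fun x y => if (x.2 : ℕ) = y.2 then D x.1 y.1 else 0) := by
  refine Matrix.ext ?_
  rintro ⟨i, s, hs⟩ ⟨j, t, ht⟩
  by_cases hij : k i = k j
  · rcases t with _ | t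
    · rw [mul_jordanMatrix_apply_zero]
      rcases (Nat.succ_le_of_lt hs).lt_or_eq with h | h
      · rw [jordanMatrix_mul_apply_of_lt _ h]
        simp
      · rw [jordanMatrix_mul_apply_of_eq _ h]
    · rw [mul_jordanMatrix_apply_succ]
      rcases (Nat.succ_le_of_lt hs).lt_or_eq with h | h
      · rw [jordanMatrix_mul_apply_of_lt _ h]
        simp
      · rw [jordanMatrix_mul_apply_of_eq _ h, Matrix.of_apply, if_neg]
        dsimp only
        omega
  · trans (0 : K)
    · rcases (Nat.succ_le_of_lt hs).lt_or_eq with h | h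
      · rw [jordanMatrix_mul_apply_of_lt _ h]
        simp [hD i j hij]
      · rw [jordanMatrix_mul_apply_of_eq _ h]
    · rcases t with _ | t
      · rw [mul_jordanMatrix_apply_zero]
      · rw [mul_jordanMatrix_apply_succ]
        simp [hD i j hij]

theorem blocksHom_surjective (hk : ∀ i, 0 < k i) :
    Function.Surjective (blocksHom (K := K) hk) := by
  intro M
  let D : Fin m → Fin m → K := fun i j =>
    if h : k j = k i then
      M ⟨k i, size_mem_Icc hk i⟩ (blockEquiv k (k i) ⟨i, rfl⟩) (blockEquiv k (k i) ⟨j, h⟩)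
    else 0
  have hD : ∀ i j, k i ≠ k j → D i j = 0 := fun i j h => dif_neg h.symm
  have key : ∀ (e : Finset.Icc 1 (maxBlockSize k)) (i j : {i // k i = (e : ℕ)}),
      D i.1 j.1 = M e (blockEquiv k e i) (blockEquiv k e j) := by
    rintro ⟨e, he⟩ ⟨i, hi⟩ ⟨j, hj⟩
    dsimp only at hi hj
    subst hi
    exact dif_pos hj
  refine ⟨⟨_, mem_jordanCen.2 (commute_jordanMatrix_of_size_eq D hD)⟩, ?_⟩
  ext e p q
  rw [blocksHom_apply]
  simp only [Matrix.of_apply, if_true]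
  rw [key, Equiv.apply_symm_apply, Equiv.apply_symm_apply]

theorem apply_zero_zero_of_mem_ker {hk : ∀ i, 0 < k i} {B : jordanCen K k}
    (hB : blocksHom hk B = 0) {i j : Fin m} (h : k i = k j) :
    B.1 ⟨i, ⟨0, hk i⟩⟩ ⟨j, ⟨0, hk j⟩⟩ = 0 := by
  have key : ∀ (e : Finset.Icc 1 (maxBlockSize k)) (p q : {i // k i = (e : ℕ)}),
      B.1 ⟨p.1, ⟨0, hk p.1⟩⟩ ⟨q.1, ⟨0, hk q.1⟩⟩ = 0 := by
    intro e p q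
    obtain ⟨p, rfl⟩ := (blockEquiv k e).symm.surjective p
    obtain ⟨q, rfl⟩ := (blockEquiv k e).symm.surjective q
    rw [← blocksHom_apply hk B e p q, hB]
    rfl
  exact key ⟨k j, size_mem_Icc hk j⟩ ⟨i, h⟩ ⟨j, rfl⟩

/-! ### Nilpotency of the kernel -/

/-- The number of different block sizes larger than the size of block `i`. -/
def numLargerSizes (k : Fin m → ℕ) (i : Fin m) : ℕ :=
  ((univ.image k).filter fun e => k i < e).card

theorem numLargerSizes_lt (k : Fin m → ℕ) (i : Fin m) :
    numLargerSizes k i < numBlockSizes k := by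
  refine card_lt_card (filter_ssubset.2 ⟨k i, mem_image_of_mem _ (mem_univ i), lt_irrefl _⟩)

theorem numLargerSizes_le_of_le {i j : Fin m} (h : k j ≤ k i) :
    numLargerSizes k i ≤ numLargerSizes k j :=
  card_le_card (monotone_filter_right _ fun _ _ he => h.trans_lt he)

theorem numLargerSizes_lt_of_lt {i j : Fin m} (h : k j < k i) :
    numLargerSizes k i < numLargerSizes k j := by
  refine card_lt_card ⟨monotone_filter_right _ fun _ _ he => h.trans he, fun hs => ?_⟩
  have := hs (mem_filter.2 ⟨mem_image_of_mem k (mem_univ i), h⟩)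
  exact lt_irrefl _ (mem_filter.1 this).2

/-- The rank of a basis vector: elements of the centralizer do not increase it, and elements of
the radical lower it. -/
def basisRank (k : Fin m → ℕ) (x : Σ i, Fin (k i)) : ℕ :=
  x.2 * numBlockSizes k + numLargerSizes k x.1

theorem basisRank_lt (x : Σ i, Fin (k i)) :
    basisRank k x < maxBlockSize k * numBlockSizes k := by
  have h1 : (x.2 : ℕ) + 1 ≤ maxBlockSize k :=
    x.2.2.trans_le (Finset.le_sup (f := k) (mem_univ x.1))
  calc basisRank k x < x.2 * numBlockSizes k + numBlockSizes k :=
        Nat.add_lt_add_left (numLargerSizes_lt k x.1) _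
    _ = (x.2 + 1) * numBlockSizes k := by ring
    _ ≤ _ := Nat.mul_le_mul_right _ h1

/-- The rank is lexicographic: its second term stays below `numBlockSizes k`, so the position
dominates. -/
theorem basisRank_lt_of_lt {x y : Σ i, Fin (k i)} (h : (x.2 : ℕ) < y.2) :
    basisRank k x < basisRank k y :=
  calc basisRank k x < x.2 * numBlockSizes k + numBlockSizes k :=
        Nat.add_lt_add_left (numLargerSizes_lt k x.1) _
    _ = (x.2 + 1) * numBlockSizes k := by ring
    _ ≤ y.2 * numBlockSizes k := Nat.mul_le_mul_right _ h
    _ ≤ _ := Nat.le_add_right _ _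

theorem basisRank_le_of_apply_ne_zero {B : Matrix (Σ i, Fin (k i)) (Σ i, Fin (k i)) K}
    (hB : Commute (jordanMatrix K k) B) {x y : Σ i, Fin (k i)} (h : B x y ≠ 0) :
    basisRank k x ≤ basisRank k y := by
  obtain ⟨i, s, hs⟩ := x
  obtain ⟨j, t, ht⟩ := y
  rcases lt_trichotomy s t with hst | rfl | hst
  · exact (basisRank_lt_of_lt hst).le
  · rw [apply_same hB] at h
    refine Nat.add_le_add_left (numLargerSizes_le_of_le (not_lt.1 fun hlt => h ?_)) _
    exact apply_zero_zero_of_lt hB _ hlt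
  · exact absurd (apply_eq_zero_of_lt hB hs ht hst) h

theorem basisRank_lt_of_mem_ker {hk : ∀ i, 0 < k i} {B : jordanCen K k}
    (hB : blocksHom hk B = 0) {x y : Σ i, Fin (k i)} (h : B.1 x y ≠ 0) :
    basisRank k x < basisRank k y := by
  have hBc := mem_jordanCen.1 B.2
  obtain ⟨i, s, hs⟩ := x
  obtain ⟨j, t, ht⟩ := y
  rcases lt_trichotomy s t with hst | rfl | hst
  · exact basisRank_lt_of_lt hst
  · rw [apply_same hBc] at h
    refine Nat.add_lt_add_left (numLargerSizes_lt_of_lt ?_) _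
    rcases lt_trichotomy (k i) (k j) with hlt | heq | hlt
    · exact absurd (apply_zero_zero_of_lt hBc _ hlt) h
    · exact absurd (apply_zero_zero_of_mem_ker hB heq) h
    · exact hlt
  · exact absurd (apply_eq_zero_of_lt hBc hs ht hst) h

/-- Each kernel factor raises the rank by at least one. The map `f` allows the powers to be taken in
`Cen A` itself, with entries read in the Jordan basis. -/
theorem basisRank_add_le_of_mem_ker_pow {R : Type*} [Ring R] [Algebra K R]
    {f : R →ₐ[K] jordanCen K k} {hk : ∀ i, 0 < k i} {r : ℕ} {B : R}
    (hB : B ∈ RingHom.ker ((blocksHom hk).comp f) ^ r) {x y : Σ i, Fin (k i)}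
    (h : (f B).1 x y ≠ 0) : basisRank k x + r ≤ basisRank k y := by
  induction r generalizing B x y with
  | zero => exact basisRank_le_of_apply_ne_zero (mem_jordanCen.1 (f B).2) h
  | succ r ih =>
    rw [Submodule.pow_succ] at hB
    induction hB using Submodule.smul_induction_on' with
    | smul C hC D hD =>
      rw [smul_eq_mul, map_mul] at h
      obtain ⟨z, -, hz⟩ := exists_ne_zero_of_sum_ne_zero (f := fun z => (f C).1 x z * (f D).1 z y) h
      have h1 := ih hC (left_ne_zero_of_mul hz)
      have h2 := basisRank_lt_of_mem_ker (hk := hk) (B := f D) hD (right_ne_zero_of_mul hz)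
      omega
    | add C _ D _ hC hD =>
      by_cases hc : (f C).1 x y = 0
      · refine hD fun hd => h ?_
        rw [map_add]
        exact (congrArg₂ (· + ·) hc hd).trans (add_zero 0)
      · exact hC hc

theorem ker_blocksHom_comp_pow_eq_bot {R : Type*} [Ring R] [Algebra K R]
    {f : R →ₐ[K] jordanCen K k} (hf : Function.Injective f) (hk : ∀ i, 0 < k i) :
    RingHom.ker ((blocksHom hk).comp f) ^ (maxBlockSize k * numBlockSizes k) = ⊥ := by
  refine (Submodule.eq_bot_iff _).2 fun B hB => hf ?_
  rw [map_zero]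
  refine Subtype.ext (Matrix.ext fun x y => ?_)
  by_contra h
  have h1 := basisRank_add_le_of_mem_ker_pow hB h
  have h2 := basisRank_lt y
  omega

/-- A basis in Jordan form identifies the centralizer with that of the Jordan matrix. -/
theorem exists_bijective_algHom_jordanCen {d : ℕ} {A : Matrix (Fin d) (Fin d) K}
    (h : HasJordanBlockSizes A k) : ∃ f : Cen A →ₐ[K] jordanCen K k, Function.Bijective f := by
  obtain ⟨b, hb⟩ := h.exists_basis
  let T : Matrix (Fin d) (Fin d) K ≃ₐ[K]
      Matrix (Σ i : Fin m, Fin (k i)) (Σ i : Fin m, Fin (k i)) K :=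
    Matrix.toLinAlgEquiv'.trans (LinearMap.toMatrixAlgEquiv b)
  have hT : T A = jordanMatrix K k := hb
  have hmem : ∀ B, T B ∈ jordanCen K k ↔ B ∈ Cen A := by
    intro B
    simp only [Subalgebra.mem_centralizer_iff, Set.mem_singleton_iff, forall_eq]
    rw [← hT, ← map_mul, ← map_mul, T.injective.eq_iff]
  refine ⟨(T.toAlgHom.comp (Cen A).val).codRestrict _ fun B => (hmem _).2 B.2, ?_, ?_⟩
  · intro B C hBC
    exact Subtype.ext (T.injective (congrArg Subtype.val hBC))
  · intro C
    refine ⟨⟨T.symm C.1, (hmem _).1 ?_⟩, Subtype.ext (T.apply_symm_apply _)⟩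
    rw [T.apply_symm_apply]
    exact C.2

end MatrixCentralizer

/-! ### Existence of the Jordan form -/

open Polynomial in
theorem Polynomial.exists_basis_quotient_X_pow (K : Type*) [Field K] (n : ℕ) :
    ∃ c : Module.Basis (Fin n) K (K[X] ⧸ (Submodule.span K[X] {(X : K[X]) ^ n})),
      ∀ s, c s = Submodule.Quotient.mk (X ^ (n - 1 - (s : ℕ))) := by
  let p := AdjoinRoot.powerBasis' (monic_X_pow (R := K) n)
  have hp : p.dim = n := natDegree_X_pow n
  let c : Module.Basis (Fin n) K (AdjoinRoot ((X : K[X]) ^ n)) :=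
    -- Powers are listed in decreasing order, so that multiplication by `X` lowers the index, as a
    -- superdiagonal block requires.
    p.basis.reindex ((finCongr hp).trans Fin.revPerm)
  have h : ∀ s : Fin n, c s = AdjoinRoot.mk ((X : K[X]) ^ n) (X ^ (n - 1 - (s : ℕ))) := by
    intro s
    rw [Module.Basis.reindex_apply, p.basis_eq_pow, map_pow, AdjoinRoot.mk_X]
    change AdjoinRoot.root ((X : K[X]) ^ n) ^ (n - (s + 1)) = _
    rw [Nat.sub_sub, Nat.add_comm 1]
  exact ⟨c, h⟩

namespace MatrixCentralizer

variable {K : Type*} [Field K]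

/-- `b` is a basis consisting of Jordan chains of `f`. -/
structure IsJordanBasis {V ι : Type*} [AddCommGroup V] [Module K V] (f : Module.End K V)
    {k : ι → ℕ} (b : Module.Basis (Σ i, Fin (k i)) K V) : Prop where
  apply_zero : ∀ i (h : 0 < k i), f (b ⟨i, ⟨0, h⟩⟩) = 0
  apply_succ : ∀ i s (h : s + 1 < k i), f (b ⟨i, ⟨s + 1, h⟩⟩) = b ⟨i, ⟨s, by omega⟩⟩

open Polynomial DirectSum in
-- With `X` acting as `f`, `V` is `X`-power torsion, hence a sum of modules `K[X] / (X ^ k i)`; the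
-- monomials in each summand form a Jordan chain.
theorem exists_isJordanBasis {V : Type*} [AddCommGroup V] [Module K V] [Module.Finite K V]
    {f : Module.End K V} (hf : IsNilpotent f) :
    ∃ (m : ℕ) (k : Fin m → ℕ) (b : Module.Basis (Σ i, Fin (k i)) K V), IsJordanBasis f b := by
  classical
  obtain ⟨N, hN⟩ := hf
  have htors : Module.IsTorsion' (Module.AEval' f) (Submonoid.powers (X : K[X])) := by
    intro x
    obtain ⟨v, rfl⟩ := (Module.AEval'.of f).surjective x
    refine ⟨⟨X ^ N, N, rfl⟩, ?_⟩
    change (X ^ N : K[X]) • Module.AEval'.of f v = 0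
    rw [Module.AEval'.X_pow_smul_of, hN]
    simp
  obtain ⟨m, k, ⟨e⟩⟩ := Module.torsion_by_prime_power_decomposition irreducible_X htors
  choose c hc using fun i => Polynomial.exists_basis_quotient_X_pow K (k i)
  let e' := e.trans (DirectSum.linearEquivFunOnFintype K[X] (Fin m)
    fun i => K[X] ⧸ Submodule.span K[X] {(X : K[X]) ^ k i})
  let E : V ≃ₗ[K] (∀ i, K[X] ⧸ Submodule.span K[X] {(X : K[X]) ^ k i}) :=
    (Module.AEval'.of f).trans (e'.restrictScalars K)
  have hE : ∀ v, E (f v) = (X : K[X]) • E v := by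
    intro v
    change e' (Module.AEval'.of f (f v)) = (X : K[X]) • e' (Module.AEval'.of f v)
    rw [← map_smul, Module.AEval'.X_smul_of]
  let b := (Pi.basis c).map E.symm
  have hb : ∀ x, E (b x) = Pi.single x.1 (Submodule.Quotient.mk (X ^ (k x.1 - 1 - x.2))) := by
    intro x
    rw [Module.Basis.map_apply, E.apply_symm_apply, Pi.basis_apply, hc]
  refine ⟨m, k, b, ⟨fun i h => E.injective ?_, fun i s h => E.injective ?_⟩⟩
  · rw [hE, map_zero, hb, ← Pi.single_smul, ← Submodule.Quotient.mk_smul, smul_eq_mul,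
      ← pow_succ', (Submodule.Quotient.mk_eq_zero _).2, Pi.single_zero]
    dsimp only
    rw [show k i - 1 - 0 + 1 = k i by omega]
    exact Submodule.mem_span_singleton_self _
  · rw [hE, hb, hb, ← Pi.single_smul, ← Submodule.Quotient.mk_smul, smul_eq_mul, ← pow_succ']
    dsimp only
    rw [show k i - 1 - (s + 1) + 1 = k i - 1 - s by omega]

/-- The decomposition may contain zero summands and is unordered: empty blocks are discarded and the
others sorted. -/
theorem IsJordanBasis.exists_antitone {V : Type*} [AddCommGroup V] [Module K V]
    {f : Module.End K V} {m : ℕ} {k : Fin m → ℕ} {b : Module.Basis (Σ i, Fin (k i)) K V}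
    (hb : IsJordanBasis f b) :
    ∃ (m' : ℕ) (k' : Fin m' → ℕ) (b' : Module.Basis (Σ i, Fin (k' i)) K V),
      Antitone k' ∧ (∀ i, 1 ≤ k' i) ∧ IsJordanBasis f b' := by
  let u := Fintype.equivFin {i // 0 < k i}
  -- The order dual turns the increasing sort into a decreasing one.
  let g : Fin (Fintype.card {i // 0 < k i}) → ℕᵒᵈ := fun i => OrderDual.toDual (k (u.symm i).1)
  let w : Fin (Fintype.card {i // 0 < k i}) ≃ {i // 0 < k i} := (Tuple.sort g).trans u.symm
  have hw : Antitone fun i => k (w i).1 := fun i j hij => Tuple.monotone_sort g hij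
  let q : (Σ i, Fin (k (w i).1)) → Σ i, Fin (k i) := fun x => ⟨(w x.1).1, x.2⟩
  have hq : Function.Bijective q := by
    constructor
    · rintro ⟨i, s⟩ ⟨j, t⟩ h
      have h1 : (w i).1 = (w j).1 := congrArg Sigma.fst h
      obtain rfl : i = j := w.injective (Subtype.ext h1)
      simpa [q] using h
    · rintro ⟨i, s⟩
      obtain ⟨j, hj⟩ := w.surjective ⟨i, s.pos⟩
      obtain rfl : (w j).1 = i := congrArg Subtype.val hj
      exact ⟨⟨j, s⟩, rfl⟩
  have hb' : ∀ x, b.reindex (Equiv.ofBijective q hq).symm x = b (q x) := fun x => by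
    rw [Module.Basis.reindex_apply, Equiv.symm_symm, Equiv.ofBijective_apply]
  refine ⟨_, _, b.reindex (Equiv.ofBijective q hq).symm, hw, fun i => (w i).2, ⟨?_, ?_⟩⟩
  · intro i h
    rw [hb']
    exact hb.apply_zero _ h
  · intro i s h
    rw [hb', hb']
    exact hb.apply_succ _ s h

end MatrixCentralizer

namespace MatrixCentralizer

theorem IsJordanBasis.toMatrix_eq {K V : Type*} [Field K] [AddCommGroup V] [Module K V]
    {f : Module.End K V} {m : ℕ} {k : Fin m → ℕ} {b : Module.Basis (Σ i, Fin (k i)) K V}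
    (hb : IsJordanBasis f b) : LinearMap.toMatrix b b f = jordanMatrix K k := by
  refine Matrix.ext fun x y => ?_
  obtain ⟨j, t, ht⟩ := y
  rw [LinearMap.toMatrix_apply, jordanMatrix_apply]
  rcases t with _ | t
  · rw [hb.apply_zero]
    simp
  · rw [hb.apply_succ, Module.Basis.repr_self, Finsupp.single_apply]
    obtain ⟨i, s, hs⟩ := x
    refine if_congr ⟨fun h => ?_, fun h => ?_⟩ rfl rfl
    · cases h
      exact ⟨rfl, rfl⟩
    · obtain ⟨h1, h2⟩ := h
      dsimp only at h1 h2
      subst h1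
      obtain rfl : s = t := by omega
      rfl

theorem exists_hasJordanBlockSizes {K : Type*} [Field K] {d : ℕ} {A : Matrix (Fin d) (Fin d) K}
    (hA : IsNilpotent A) : ∃ (m : ℕ) (k : Fin m → ℕ), HasJordanBlockSizes A k := by
  have hf : IsNilpotent (Matrix.toLin' A) := hA.map (Matrix.toLinAlgEquiv' (R := K))
  obtain ⟨_, _, _, hb⟩ := exists_isJordanBasis hf
  obtain ⟨m, k, b, hanti, hone, hb⟩ := hb.exists_antitone
  exact ⟨m, k, hanti, hone, b, hb.toMatrix_eq⟩

end MatrixCentralizer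

/-- A nilpotent matrix has a Jordan form, and for the sizes of its blocks, the centralizer modulo
its Jacobson radical is the direct product of the matrix algebras of sizes `p_e`, while the
Jacobson radical is nilpotent of index at most `n * v`. -/
theorem theorem6p1 {K : Type*} [Field K] {d : ℕ} (A : Matrix (Fin d) (Fin d) K)
    (hA : IsNilpotent A) :
    (∃ (m : ℕ) (k : Fin m → ℕ), MatrixCentralizer.HasJordanBlockSizes A k) ∧
    ∀ (m : ℕ) (k : Fin m → ℕ), MatrixCentralizer.HasJordanBlockSizes A k →
      Nonempty
        ((MatrixCentralizer.Cen A ⧸ Ring.jacobson (MatrixCentralizer.Cen A)) ≃ₐ[K]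
          ((e : Finset.Icc 1 (MatrixCentralizer.maxBlockSize k)) →
            Matrix (Fin (MatrixCentralizer.blockCount k e))
              (Fin (MatrixCentralizer.blockCount k e)) K)) ∧
      IsNilpotent (Ring.jacobson (MatrixCentralizer.Cen A)) ∧
      nilpotencyClass (Ring.jacobson (MatrixCentralizer.Cen A)) ≤
        MatrixCentralizer.maxBlockSize k * MatrixCentralizer.numBlockSizes k := by
  refine ⟨MatrixCentralizer.exists_hasJordanBlockSizes hA, fun m k h => ?_⟩
  obtain ⟨f, hf⟩ := MatrixCentralizer.exists_bijective_algHom_jordanCen h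
  have hk : ∀ i, 0 < k i := h.one_le
  exact AlgHom.nonempty_quotient_jacobson_algEquiv
    (f := (MatrixCentralizer.blocksHom hk).comp f)
    ((MatrixCentralizer.blocksHom_surjective hk).comp hf.2)
    (MatrixCentralizer.ker_blocksHom_comp_pow_eq_bot hf.1 hk)
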